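/- Let all Banach spaces be over $\mathbb K=\mathbb R$ or $\mathbb K=\mathbb C$, and let $B_E$ denote the closed unit ball of $E$. We use the following notions. Greedy errors: for a compact set $\mathcal K$ in a Banach space $X$, a run of the greedy algorithm is any sequence $(f_n)_{n\ge0}$ in $\mathcal K$ such that, with $V_n=\operatorname{span}\{f_0,\dots,f_{n-1}\}$ (so $V_0=\{0\}$), $\operatorname{dist}(f_n,V_n)_X=\max_{f\in\mathcal K}\operatorname{dist}(f,V_n)_X$ for all $n\ge 0$; put $\sigma_n(\mathcal K)_X=\operatorname{dist}(f_n,V_n)_X$ for that run. Kolmogorov widths: for a bounded operator $T:E\to X$, $d_n(T)=\inf_{L}\sup_{\|x\|\le1}\operatorname{dist}(Tx,L)_X$, the infimum being over subspaces $L\subset X$ with $\dim L\le n$; thus $d_0(T)=\|T\|$. Grothendieck numbers: $\Gamma_n(X)=\sup\big\{|\det(\langle x_i,b_j\rangle)_{i,j=1}^n|^{1/n}:\ x_1,\dots,x_n\in B_X,\ b_1,\dots,b_n\in B_{X'}\big\}$. (a) Let $X$ be a Banach space, $T:\ell_2\to X$ a compact operator and $\mathcal K\subset T(B_{\ell_2})$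 a compact set. Then, for every run of the greedy algorithm for $\mathcal K$, $$\sigma_{3n-1}(\mathcal K)_X\le 3e^2\,\Gamma_n(X)\Big(\prod_{k=0}^{n-1}d_k(T)\Big)^{1/n},\qquad n\ge1.$$ (b) Let $1\le p\le\infty$, $s>|\tfrac12-\tfrac1p|$ and $C_0,M\in\mathbb R$. There is a constant $C>0$, depending only on $\mathbb K,p,s,C_0,M$, such that for every measure space $(\Omega,\mu)$, every compact operator $T:\ell_2\to L_p(\mu)$ with $\|T\|\le M$ and $d_n(T)\le C_0n^{-s}$ for all $n\ge1$, every compact set $\mathcal K\subset T(B_{\ell_2})$ and every run of the greedy algorithm for $\mathcal K$, $$\sigma_{3n-1}(\mathcal K)_{L_p}\le C\,n^{|1/p-1/2|-s},\qquad n\ge1.$$ -/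

import Mathlib

open scoped ENNReal

noncomputable section

/-- The subspace `V_n = span {f_0, …, f_{n-1}}`; in particular `V_0 = {0}`. -/
def greedySpace (𝕜 : Type*) [RCLike 𝕜] {X : Type*} [NormedAddCommGroup X] [NormedSpace 𝕜 X]
    (f : ℕ → X) (n : ℕ) : Submodule 𝕜 X :=
  Submodule.span 𝕜 (f '' Set.Iio n)

/-- `f` is a possible output of the greedy algorithm for `K`: each `f_n` lies in `K` and realises
the maximum over `K` of the distance to `V_n`. For `n = 0` the distance to `V_0 = {0}` is the
norm. -/
def IsGreedySequence (𝕜 : Type*) [RCLike 𝕜] {X : Type*} [NormedAddCommGroup X]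
    [NormedSpace 𝕜 X] (K : Set X) (f : ℕ → X) : Prop :=
  ∀ n, f n ∈ K ∧ ∀ g ∈ K, Metric.infDist g (greedySpace 𝕜 f n : Set X) ≤
    Metric.infDist (f n) (greedySpace 𝕜 f n : Set X)

/-- The greedy error `σ_n = dist (f_n, V_n)` of a run `f` of the greedy algorithm. -/
def greedyError (𝕜 : Type*) [RCLike 𝕜] {X : Type*} [NormedAddCommGroup X] [NormedSpace 𝕜 X]
    (f : ℕ → X) (n : ℕ) : ℝ :=
  Metric.infDist (f n) (greedySpace 𝕜 f n : Set X)

/-- The Kolmogorov `n`-width of a bounded set `K`: the infimum over subspaces `L` of dimension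
at most `n` of `sup_{f ∈ K} dist (f, L)`. -/
def kolmogorovWidth (𝕜 : Type*) [RCLike 𝕜] {X : Type*} [NormedAddCommGroup X]
    [NormedSpace 𝕜 X] (K : Set X) (n : ℕ) : ℝ :=
  ⨅ L : {L : Submodule 𝕜 X // FiniteDimensional 𝕜 L ∧ Module.finrank 𝕜 L ≤ n},
    ⨆ f : K, Metric.infDist (f : X) (L.1 : Set X)

/-- The Kolmogorov `n`-width `d_n(T) = d_n(T(B_E))` of a bounded operator, `B_E` being the closed
unit ball. In particular `d_0(T) = ‖T‖`. -/
def kolmogorovNumber {𝕜 : Type*} [RCLike 𝕜] {E X : Type*} [NormedAddCommGroup E]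
    [NormedSpace 𝕜 E] [NormedAddCommGroup X] [NormedSpace 𝕜 X] (T : E →L[𝕜] X) (n : ℕ) : ℝ :=
  kolmogorovWidth 𝕜 (T '' Metric.closedBall 0 1) n

/-- The `n`-th Grothendieck number of a bounded operator `T : X → Y`: the supremum of
`|det (⟨T x_i, b_j⟩)|^(1/n)` over `x_1, …, x_n` in the unit ball of `X` and `b_1, …, b_n` in the
unit ball of the dual of `Y`. -/
def grothendieckNumber {𝕜 : Type*} [RCLike 𝕜] {X Y : Type*} [NormedAddCommGroup X]
    [NormedSpace 𝕜 X] [NormedAddCommGroup Y] [NormedSpace 𝕜 Y] (T : X →L[𝕜] Y) (n : ℕ) : ℝ :=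
  sSup {r : ℝ | ∃ (x : Fin n → X) (b : Fin n → StrongDual 𝕜 Y),
    (∀ i, ‖x i‖ ≤ 1) ∧ (∀ j, ‖b j‖ ≤ 1) ∧
      r = ‖(Matrix.of fun i j => b j (T (x i))).det‖ ^ (1 / (n : ℝ))}

/-- The `n`-th Grothendieck number of a space, `Γ_n(X) = Γ_n(id_X)`. -/
def grothendieckNumberSpace (𝕜 : Type*) [RCLike 𝕜] (X : Type*) [NormedAddCommGroup X]
    [NormedSpace 𝕜 X] (n : ℕ) : ℝ :=
  grothendieckNumber (ContinuousLinearMap.id 𝕜 X) n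

end

/-! For a greedy run, Hahn–Banach gives functionals `b j` in the dual unit ball that vanish on `V_j`
and take the value `σ_j` at `f j`. The matrix `b j (f i)` is triangular, so its determinant is `σ_0
⋯ σ_{n-1}`, which is at least `σ_{n-1} ^ n` by monotonicity. With `f i = T (x i)`, part (a) reduces
to `|det (b j (T (x i)))| ≤ Γ_n ^ n * ∏ d_k(T)`
(`norm_det_apply_le_grothendieckNumberSpace_pow_mul_prod`). This bounds `σ_{n-1}`, hence `σ_{3n-1}`,
with constant 1.

For the determinant bound, replace the `b j` by unit functionals `c r` in their span, `c r`
vanishing on a near-optimal subspace of dimension at most `n-1-r` and on earlier test vectors `y k`,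
and almost norming at `y r`. Triangularity at the `y`'s bounds the change-of-basis determinant below
in terms of `Γ_n`; Hadamard's inequality in the Hilbert space bounds `det (c r (T (x i)))` by `∏
d_k(T)`.

Part (b) adds `Γ_n(L_p) ≤ n ^ |1/p - 1/2|`: simple functions reduce it to `ℓ_p`, where the three
lines theorem interpolates Hadamard's inequality. The widths are multiplied using a lower bound for
`(n-1)!`. -/

/-! ### Hadamard's determinant inequality. -/

/-- In the Gram–Schmidt basis of `v` the determinant is a product of inner products, each at most
`‖v i‖`; passing between orthonormal bases costs a factor of modulus one. -/
theorem OrthonormalBasis.norm_det_toBasis_le {𝕜 E ι : Type*} [RCLike 𝕜] [NormedAddCommGroup E]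
    [InnerProductSpace 𝕜 E] [Fintype ι] [DecidableEq ι] (e : OrthonormalBasis ι 𝕜 E) (v : ι → E) :
    ‖e.toBasis.det v‖ ≤ ∏ i, ‖v i‖ := by
  classical
  have : FiniteDimensional 𝕜 E := e.toBasis.finiteDimensional_of_finite
  obtain ⟨n, ⟨σ⟩⟩ := Finite.exists_equiv_fin ι
  have hdim : Module.finrank 𝕜 E = Fintype.card (Fin n) := by
    rw [Module.finrank_eq_card_basis e.toBasis, Fintype.card_congr σ]
  set g := InnerProductSpace.gramSchmidtOrthonormalBasis hdim (v ∘ σ.symm) with hg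
  have h1 : g.toBasis.det (v ∘ σ.symm) = ∏ i, inner 𝕜 (g i) ((v ∘ σ.symm) i) :=
    InnerProductSpace.gramSchmidtOrthonormalBasis_det hdim (v ∘ σ.symm)
  have h2 : e.toBasis.det v = (e.reindex σ).toBasis.det (v ∘ σ.symm) := by
    rw [OrthonormalBasis.reindex_toBasis, Module.Basis.det_reindex]
    congr 1
    ext i
    simp
  have h3 : (e.reindex σ).toBasis.det (v ∘ σ.symm) =
      (e.reindex σ).toBasis.det g * g.toBasis.det (v ∘ σ.symm) := by
    rw [← OrthonormalBasis.coe_toBasis g, Module.Basis.det_apply, Module.Basis.det_apply,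
      Module.Basis.det_apply, ← Matrix.det_mul, Module.Basis.toMatrix_mul_toMatrix]
  have h4 : ‖(e.reindex σ).toBasis.det g‖ = 1 :=
    (e.reindex σ).det_to_matrix_orthonormalBasis g
  rw [h2, h3, norm_mul, h4, one_mul, h1, norm_prod]
  calc ∏ i, ‖inner 𝕜 (g i) ((v ∘ σ.symm) i)‖ ≤ ∏ i, ‖(v ∘ σ.symm) i‖ := by
        refine Finset.prod_le_prod (fun _ _ => norm_nonneg _) fun i _ => ?_
        simpa using norm_inner_le_norm (𝕜 := 𝕜) (g i) ((v ∘ σ.symm) i)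
    _ = ∏ i, ‖v i‖ := by
        simpa using σ.symm.prod_comp (fun i => ‖v i‖)

/-- **Hadamard's inequality** for matrices of inner products. -/
theorem norm_det_inner_le {𝕜 E ι : Type*} [RCLike 𝕜] [NormedAddCommGroup E]
    [InnerProductSpace 𝕜 E] [Fintype ι] [DecidableEq ι] (x y : ι → E) :
    ‖(Matrix.of fun i j => inner 𝕜 (x i) (y j)).det‖ ≤ (∏ i, ‖x i‖) * ∏ i, ‖y i‖ := by
  classical
  by_cases hx : LinearIndependent 𝕜 x
  · set S := Submodule.span 𝕜 (Set.range x) with hS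
    have : FiniteDimensional 𝕜 S := FiniteDimensional.span_of_finite 𝕜 (Set.finite_range x)
    have hdim : Module.finrank 𝕜 S = Fintype.card ι := finrank_span_eq_card hx
    let e : OrthonormalBasis ι 𝕜 S := (stdOrthonormalBasis 𝕜 S).reindex
      (Fintype.equivOfCardEq (by simp [hdim]))
    let x' : ι → S := fun i => ⟨x i, Submodule.subset_span ⟨i, rfl⟩⟩
    let y' : ι → S := fun i => S.orthogonalProjectionOnto (y i)
    -- The span of `x` has dimension `card ι`, so projecting `y` to it factors the matrix into two
    -- square coordinate matrices.
    have key : (Matrix.of fun i j => inner 𝕜 (x i) (y j)) =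
        (e.toBasis.toMatrix x').conjTranspose * e.toBasis.toMatrix y' := by
      ext i j
      have h : inner 𝕜 (x i) (y j) = inner 𝕜 (x' i) (y' j) := by
        rw [Submodule.coe_inner]
        have := Submodule.inner_orthogonalProjectionOnto_eq_of_mem_left (x' i) (y j)
        exact this.symm
      rw [Matrix.of_apply, h, ← e.sum_inner_mul_inner, Matrix.mul_apply]
      refine Finset.sum_congr rfl fun k _ => ?_
      simp [Module.Basis.toMatrix_apply, OrthonormalBasis.repr_apply_apply]
    rw [key, Matrix.det_mul, norm_mul, Matrix.det_conjTranspose, norm_star]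
    have hy' : ∀ i, ‖y' i‖ ≤ ‖y i‖ := fun i => S.norm_orthogonalProjectionOnto_apply_le (y i)
    refine mul_le_mul (e.norm_det_toBasis_le x') ((e.norm_det_toBasis_le y').trans ?_)
      (norm_nonneg _) (Finset.prod_nonneg fun _ _ => norm_nonneg _)
    exact Finset.prod_le_prod (fun _ _ => norm_nonneg _) fun i _ => hy' i
  · obtain ⟨g, hg, i, hi⟩ := Fintype.not_linearIndependent_iff.1 hx
    have : (Matrix.of fun i j => inner 𝕜 (x i) (y j)).det = 0 := by
      refine Matrix.exists_vecMul_eq_zero_iff.1 ⟨fun i => star (g i), ?_, ?_⟩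
      · intro h
        exact hi (star_eq_zero.1 (congrFun h i))
      · ext j
        have h : inner 𝕜 (∑ i, g i • x i) (y j) = 0 := by rw [hg, inner_zero_left]
        simpa [sum_inner, inner_smul_left, Matrix.vecMul, dotProduct] using h
    rw [this, norm_zero]
    positivity

/-- **Hadamard's inequality** for a product of two rectangular matrices. -/
theorem Matrix.norm_det_mul_le {𝕜 ι κ : Type*} [RCLike 𝕜] [Fintype ι] [DecidableEq ι] [Fintype κ]
    (A : Matrix ι κ 𝕜) (B : Matrix κ ι 𝕜) :
    ‖(A * B).det‖ ≤ (∏ i, √(∑ k, ‖A i k‖ ^ 2)) * ∏ j, √(∑ k, ‖B k j‖ ^ 2) := by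
  have h := norm_det_inner_le (𝕜 := 𝕜) (fun i => WithLp.toLp 2 (fun k => star (A i k)))
    (fun j => WithLp.toLp 2 (fun k => B k j))
  have e : (Matrix.of fun i j => inner 𝕜 (WithLp.toLp 2 (fun k => star (A i k)))
    (WithLp.toLp 2 (fun k => B k j))) = A * B := by
    ext i j
    simp [PiLp.inner_apply, Matrix.mul_apply, mul_comm]
  rw [e] at h
  simpa [EuclideanSpace.norm_eq] using h

theorem Matrix.norm_det_le_of_norm_entry_le {𝕜 ι : Type*} [RCLike 𝕜] [Fintype ι] [DecidableEq ι]
    (A : Matrix ι ι 𝕜) {c : ℝ} (hc : 0 ≤ c) (h : ∀ i j, ‖A i j‖ ≤ c) :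
    ‖A.det‖ ≤ (√(Fintype.card ι) * c) ^ Fintype.card ι := by
  have := Matrix.norm_det_mul_le A 1
  rw [mul_one] at this
  refine this.trans ?_
  have h1 : ∏ j : ι, √(∑ k, ‖(1 : Matrix ι ι 𝕜) k j‖ ^ 2) = 1 := by
    refine Finset.prod_eq_one fun j _ => ?_
    rw [Finset.sum_eq_single j] <;> simp +contextual
  rw [h1, mul_one, ← Finset.card_univ, ← Finset.prod_const]
  refine Finset.prod_le_prod (fun _ _ => Real.sqrt_nonneg _) fun i _ => ?_
  rw [← Real.sqrt_sq hc, ← Real.sqrt_mul (by positivity)]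
  refine Real.sqrt_le_sqrt ?_
  rw [← nsmul_eq_mul]
  exact Finset.sum_le_card_nsmul _ _ _ fun k _ => by gcongr; exact h i k

theorem Real.rpow_inv_natCast_le_iff {x y : ℝ} {n : ℕ} (hn : n ≠ 0) (hx : 0 ≤ x) (hy : 0 ≤ y) :
    x ^ (n⁻¹ : ℝ) ≤ y ↔ x ≤ y ^ n := by
  rw [Real.rpow_inv_le_iff_of_pos hx hy (by positivity), Real.rpow_natCast]

/-! ### Grothendieck numbers, Kolmogorov numbers and determinants of operators. -/

section Grothendieck

variable {𝕜 : Type*} [RCLike 𝕜] {X Y : Type*} [NormedAddCommGroup X] [NormedSpace 𝕜 X]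
  [NormedAddCommGroup Y] [NormedSpace 𝕜 Y]

theorem grothendieckNumberSpace_nonneg (n : ℕ) : 0 ≤ grothendieckNumberSpace 𝕜 X n := by
  refine Real.sSup_nonneg ?_
  rintro r ⟨x, b, -, -, rfl⟩
  positivity

theorem norm_det_dual_apply_le {n : ℕ} {x : Fin n → X} {b : Fin n → StrongDual 𝕜 X}
    (hx : ∀ i, ‖x i‖ ≤ 1) (hb : ∀ j, ‖b j‖ ≤ 1) :
    ‖(Matrix.of fun i j => b j (x i)).det‖ ≤ √n ^ n := by
  have := Matrix.norm_det_le_of_norm_entry_le (Matrix.of fun i j => b j (x i)) zero_le_one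
    fun i j => (b j).unit_le_opNorm (x i) (hx i) |>.trans (hb j)
  simpa using this

theorem grothendieckNumberSpace_le {n : ℕ} (hn : n ≠ 0) {c : ℝ} (hc : 0 ≤ c)
    (h : ∀ (x : Fin n → X) (b : Fin n → StrongDual 𝕜 X), (∀ i, ‖x i‖ ≤ 1) → (∀ j, ‖b j‖ ≤ 1) →
      ‖(Matrix.of fun i j => b j (x i)).det‖ ≤ c ^ n) :
    grothendieckNumberSpace 𝕜 X n ≤ c := by
  refine Real.sSup_le ?_ hc
  rintro r ⟨x, b, hx, hb, rfl⟩
  rw [one_div]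
  exact (Real.rpow_inv_natCast_le_iff hn (norm_nonneg _) hc).2 (h x b hx hb)

theorem grothendieckNumberSpace_le_sqrt {n : ℕ} (hn : n ≠ 0) :
    grothendieckNumberSpace 𝕜 X n ≤ √n :=
  grothendieckNumberSpace_le hn (Real.sqrt_nonneg _) fun _ _ => norm_det_dual_apply_le

theorem norm_det_dual_apply_le_grothendieckNumberSpace_pow {n : ℕ} (hn : n ≠ 0) {x : Fin n → X}
    {b : Fin n → StrongDual 𝕜 X} (hx : ∀ i, ‖x i‖ ≤ 1) (hb : ∀ j, ‖b j‖ ≤ 1) :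
    ‖(Matrix.of fun i j => b j (x i)).det‖ ≤ grothendieckNumberSpace 𝕜 X n ^ n := by
  -- A real `sSup` dominates its members only when the set is bounded; Hadamard supplies the bound
  -- `√n`.
  have hbdd : BddAbove {r : ℝ | ∃ (x : Fin n → X) (b : Fin n → StrongDual 𝕜 X),
      (∀ i, ‖x i‖ ≤ 1) ∧ (∀ j, ‖b j‖ ≤ 1) ∧
      r = ‖(Matrix.of fun i j => b j (x i)).det‖ ^ (1 / (n : ℝ))} := by
    refine ⟨√n, ?_⟩
    rintro r ⟨x, b, hx, hb, rfl⟩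
    rw [one_div]
    exact (Real.rpow_inv_natCast_le_iff hn (norm_nonneg _) (Real.sqrt_nonneg _)).2
      (norm_det_dual_apply_le hx hb)
  have : _ ^ (1 / (n : ℝ)) ≤ grothendieckNumberSpace 𝕜 X n := le_csSup hbdd ⟨x, b, hx, hb, rfl⟩
  rw [one_div] at this
  exact (Real.rpow_inv_natCast_le_iff hn (norm_nonneg _)
    (grothendieckNumberSpace_nonneg n)).1 this

/-- A nontrivial linear combination of `n` functionals vanishing on a given subspace of dimension
less than `n`. -/
theorem exists_ne_zero_sum_smul_vanishing {n : ℕ} (b : Fin n → StrongDual 𝕜 X)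
    (W : Submodule 𝕜 X) [FiniteDimensional 𝕜 W] (hW : Module.finrank 𝕜 W < n) :
    ∃ a : Fin n → 𝕜, a ≠ 0 ∧ ∀ w ∈ W, (∑ j, a j • b j) w = 0 := by
  let F : (Fin n → 𝕜) →ₗ[𝕜] Module.Dual 𝕜 W :=
    Fintype.linearCombination 𝕜 fun j => (b j : X →ₗ[𝕜] 𝕜) ∘ₗ W.subtype
  have hF : LinearMap.ker F ≠ ⊥ := F.ker_ne_bot_of_finrank_lt (by
    rw [Subspace.dual_finrank_eq]; simpa using hW)
  obtain ⟨a, ha, ha0⟩ := Submodule.exists_mem_ne_zero_of_ne_bot hF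
  refine ⟨a, ha0, fun w hw => ?_⟩
  have := LinearMap.congr_fun (LinearMap.mem_ker.1 ha) ⟨w, hw⟩
  simpa [F, Fintype.linearCombination_apply] using this

theorem exists_norm_one_sum_smul_vanishing {n : ℕ} {b : Fin n → StrongDual 𝕜 X}
    (hb : LinearIndependent 𝕜 b) (W : Submodule 𝕜 X) [FiniteDimensional 𝕜 W]
    (hW : Module.finrank 𝕜 W < n) :
    ∃ a : Fin n → 𝕜, ‖∑ j, a j • b j‖ = 1 ∧ ∀ w ∈ W, (∑ j, a j • b j) w = 0 := by
  obtain ⟨a, ha, h⟩ := exists_ne_zero_sum_smul_vanishing b W hW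
  have h0 : ∑ j, a j • b j ≠ 0 := fun h0 =>
    ha (funext (Fintype.linearIndependent_iff.1 hb a h0))
  refine ⟨fun j => (‖∑ j, a j • b j‖⁻¹ : 𝕜) * a j, ?_, fun w hw => ?_⟩
  · simp_rw [mul_smul, ← Finset.smul_sum]
    exact_mod_cast norm_smul_inv_norm (𝕜 := 𝕜) h0
  · simp_rw [mul_smul, ← Finset.smul_sum]
    rw [smul_apply, h w hw, smul_zero]

/-- Triangular systems: normalised functionals in the span of `b`, the `r`-th vanishing on `L r`
and on the vectors `y 0, …, y (r - 1)`, and almost attaining its norm at `y r`. -/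
theorem exists_triangular_system {n : ℕ} {b : Fin n → StrongDual 𝕜 X}
    (hb : LinearIndependent 𝕜 b) (L : ℕ → Submodule 𝕜 X) (hL : ∀ r, FiniteDimensional 𝕜 (L r))
    (hLr : ∀ r < n, Module.finrank 𝕜 (L r) + r < n) {η : ℝ} (hη : η < 1) :
    ∀ m ≤ n, ∃ (a : ℕ → Fin n → 𝕜) (y : ℕ → X), ∀ r < m, ‖∑ j, a r j • b j‖ = 1 ∧
      (∀ w ∈ L r, (∑ j, a r j • b j) w = 0) ∧ (∀ k < r, (∑ j, a r j • b j) (y k) = 0) ∧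
      ‖y r‖ ≤ 1 ∧ η ≤ ‖(∑ j, a r j • b j) (y r)‖ := by
  intro m
  induction m with
  | zero => exact fun _ => ⟨0, 0, fun r hr => absurd hr (Nat.not_lt_zero r)⟩
  | succ m ih =>
    intro hm
    obtain ⟨a, y, h⟩ := ih (Nat.le_of_succ_le hm)
    let S : Submodule 𝕜 X := Submodule.span 𝕜 (Set.range fun k : Fin m => y k)
    have := hL m
    have hS : FiniteDimensional 𝕜 S := FiniteDimensional.span_of_finite 𝕜 (Set.finite_range _)
    have hdim : Module.finrank 𝕜 (L m ⊔ S : Submodule 𝕜 X) < n := by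
      have h1 := Submodule.finrank_add_le_finrank_add_finrank (L m) S
      have h2 : Module.finrank 𝕜 S ≤ m := (finrank_range_le_card _).trans (by simp)
      have h3 := hLr m hm
      omega
    obtain ⟨a', ha', hv⟩ := exists_norm_one_sum_smul_vanishing hb (L m ⊔ S) hdim
    obtain ⟨y', hy', hη'⟩ := ContinuousLinearMap.exists_lt_apply_of_lt_opNorm
      (∑ j, a' j • b j) (hη.trans_eq ha'.symm)
    refine ⟨Function.update a m a', Function.update y m y', fun r hr => ?_⟩
    rcases (Nat.lt_succ_iff.1 hr).lt_or_eq with hr | rfl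
    · rw [Function.update_of_ne hr.ne, Function.update_of_ne hr.ne]
      obtain ⟨h1, h2, h3, h4⟩ := h r hr
      refine ⟨h1, h2, fun k hk => ?_, h4⟩
      rw [Function.update_of_ne (hk.trans hr).ne]
      exact h3 k hk
    · rw [Function.update_self, Function.update_self]
      refine ⟨ha', fun w hw => hv w (Submodule.mem_sup_left hw), fun k hk => ?_, hy'.le, hη'.le⟩
      rw [Function.update_of_ne hk.ne]
      exact hv _ (Submodule.mem_sup_right (Submodule.subset_span ⟨⟨k, hk⟩, rfl⟩))

theorem norm_apply_le_infDist {c : StrongDual 𝕜 X} (hc : ‖c‖ ≤ 1) {W : Submodule 𝕜 X}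
    (hW : ∀ w ∈ W, c w = 0) (x : X) : ‖c x‖ ≤ Metric.infDist x (W : Set X) := by
  refine (Metric.le_infDist ⟨0, W.zero_mem⟩).2 fun w hw => ?_
  rw [dist_eq_norm, ← sub_zero (c x), ← hW w hw, ← map_sub]
  exact (c.le_opNorm _).trans (mul_le_of_le_one_left (norm_nonneg _) hc)

variable {H : Type*} [NormedAddCommGroup H] [InnerProductSpace 𝕜 H] [CompleteSpace H]

/-- Hadamard's inequality for functionals on a Hilbert space. -/
theorem norm_det_dual_apply_le_prod {n : ℕ} (x : Fin n → H) (φ : Fin n → StrongDual 𝕜 H) :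
    ‖(Matrix.of fun i j => φ j (x i)).det‖ ≤ (∏ i, ‖x i‖) * ∏ j, ‖φ j‖ := by
  have h := norm_det_inner_le (𝕜 := 𝕜) (fun j => (InnerProductSpace.toDual 𝕜 H).symm (φ j)) x
  rw [← Matrix.det_transpose] at h
  have e : (Matrix.of fun i j => inner 𝕜 ((InnerProductSpace.toDual 𝕜 H).symm (φ i)) (x j)).transpose =
      Matrix.of fun i j => φ j (x i) := by
    ext i j
    simp [Matrix.transpose_apply]
  rw [e] at h
  simpa [mul_comm] using h

/-- The core estimate: one coefficient matrix `A` turns `b` into the triangular system `c`, both at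
the `y i` and at the `T (x i)`, so the two determinants can be compared. -/
theorem pow_mul_norm_det_le_of_infDist_le {n : ℕ} (T : H →L[𝕜] X) (L : ℕ → Submodule 𝕜 X)
    (hL : ∀ k, FiniteDimensional 𝕜 (L k)) (hLk : ∀ k, Module.finrank 𝕜 (L k) ≤ k) (δ : ℕ → ℝ)
    (hδ0 : ∀ k, 0 ≤ δ k) (hδ : ∀ k x, ‖x‖ ≤ 1 → Metric.infDist (T x) (L k : Set X) ≤ δ k)
    {x : Fin n → H} {b : Fin n → StrongDual 𝕜 X} (hx : ∀ i, ‖x i‖ ≤ 1) (hb : ∀ j, ‖b j‖ ≤ 1)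
    {η : ℝ} (hη0 : 0 ≤ η) (hη : η < 1) :
    η ^ n * ‖(Matrix.of fun i j => b j (T (x i))).det‖ ≤
      grothendieckNumberSpace 𝕜 X n ^ n * ∏ k ∈ Finset.range n, δ k := by
  have hpos : 0 ≤ grothendieckNumberSpace 𝕜 X n ^ n * ∏ k ∈ Finset.range n, δ k :=
    mul_nonneg (pow_nonneg (grothendieckNumberSpace_nonneg n) n)
      (Finset.prod_nonneg fun _ _ => hδ0 _)
  rcases Nat.eq_zero_or_pos n with rfl | hn
  · simp
  by_cases hlin : LinearIndependent 𝕜 b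
  swap
  · obtain ⟨g, hg, i, hi⟩ := Fintype.not_linearIndependent_iff.1 hlin
    have : (Matrix.of fun i j => b j (T (x i))).det = 0 := by
      refine Matrix.exists_mulVec_eq_zero_iff.1 ⟨g, fun h => hi (congrFun h i), ?_⟩
      ext j
      have h : (∑ i, g i • b i) (T (x j)) = 0 := by rw [hg]; rfl
      simpa [Matrix.mulVec, dotProduct, mul_comm] using h
    rw [this, norm_zero, mul_zero]
    exact hpos
  -- The conditions on the `r`-th functional number at most `(n - 1 - r) + r < n`, so a nonzero
  -- combination of the `b j` remains.
  obtain ⟨a, y, h⟩ := exists_triangular_system hlin (fun r => L (n - 1 - r)) (fun _ => hL _)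
    (fun r hr => by have := hLk (n - 1 - r); omega) hη n le_rfl
  let c : ℕ → StrongDual 𝕜 X := fun r => ∑ j, a r j • b j
  let A : Matrix (Fin n) (Fin n) 𝕜 := Matrix.of fun j r => a r j
  have hmul : ∀ v : Fin n → X, (Matrix.of fun i j => b j (v i)) * A =
      Matrix.of fun i r : Fin n => c r (v i) := by
    intro v
    ext i r
    simp [Matrix.mul_apply, A, c, mul_comm]
  have hy := norm_det_dual_apply_le_grothendieckNumberSpace_pow hn.ne' (x := fun i : Fin n => y i)
    (fun i => (h i i.2).2.2.2.1) hb
  have htri : η ^ n ≤ ‖(Matrix.of fun i r : Fin n => c r (y i)).det‖ := by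
    rw [Matrix.det_of_isLowerTriangular, norm_prod]
    · calc η ^ n = ∏ _i : Fin n, η := by simp
        _ ≤ _ := Finset.prod_le_prod (fun _ _ => hη0) fun i _ => (h i i.2).2.2.2.2
    · intro i r hir
      exact (h r r.2).2.2.1 i hir
  have hT : ‖(Matrix.of fun i r : Fin n => c r (T (x i))).det‖ ≤ ∏ k ∈ Finset.range n, δ k := by
    have h1 := norm_det_dual_apply_le_prod x (fun r : Fin n => c r ∘L T)
    refine h1.trans ?_
    -- The `r`-th functional is paired with `δ (n - 1 - r)`, so the product is reversed.
    rw [← Finset.prod_range_reflect, ← Fin.prod_univ_eq_prod_range (fun r => δ (n - 1 - r))]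
    refine (mul_le_of_le_one_left (Finset.prod_nonneg fun _ _ => norm_nonneg _)
      (Finset.prod_le_one (fun _ _ => norm_nonneg _) fun i _ => hx i)).trans ?_
    refine Finset.prod_le_prod (fun _ _ => norm_nonneg _) fun r _ => ?_
    refine ContinuousLinearMap.opNorm_le_of_unit_norm (hδ0 _) fun z hz => ?_
    exact (norm_apply_le_infDist (h r r.2).1.le (h r r.2).2.1 (T z)).trans (hδ _ z hz.le)
  -- Both bounds now contain `‖A.det‖`; multiplying them crosswise eliminates it without a division.
  rw [← hmul, Matrix.det_mul, norm_mul] at htri hT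
  calc η ^ n * ‖(Matrix.of fun i j => b j (T (x i))).det‖
      ≤ (‖(Matrix.of fun i j : Fin n => b j (y i)).det‖ * ‖A.det‖) *
        ‖(Matrix.of fun i j => b j (T (x i))).det‖ := by gcongr
    _ = ‖(Matrix.of fun i j : Fin n => b j (y i)).det‖ *
        (‖(Matrix.of fun i j => b j (T (x i))).det‖ * ‖A.det‖) := by ring
    _ ≤ _ := mul_le_mul hy hT (by positivity) (pow_nonneg (grothendieckNumberSpace_nonneg n) n)

theorem kolmogorovNumber_nonneg (T : X →L[𝕜] Y) (n : ℕ) : 0 ≤ kolmogorovNumber T n :=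
  Real.iInf_nonneg fun _ => Real.iSup_nonneg fun _ => Metric.infDist_nonneg

theorem infDist_submodule_le_norm (x : X) (W : Submodule 𝕜 X) :
    Metric.infDist x (W : Set X) ≤ ‖x‖ := by
  simpa using Metric.infDist_le_dist_of_mem (x := x) W.zero_mem

theorem bddAbove_infDist_image_closedBall (T : X →L[𝕜] Y) (W : Submodule 𝕜 Y) :
    BddAbove (Set.range fun f : T '' Metric.closedBall 0 1 =>
      Metric.infDist (f : Y) (W : Set Y)) := by
  refine ⟨‖T‖, ?_⟩
  rintro _ ⟨⟨_, x, hx, rfl⟩, rfl⟩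
  exact (infDist_submodule_le_norm _ _).trans
    (T.unit_le_opNorm x (by simpa using hx))

theorem exists_submodule_infDist_lt (T : X →L[𝕜] Y) (n : ℕ) {δ : ℝ}
    (hδ : kolmogorovNumber T n < δ) :
    ∃ W : Submodule 𝕜 Y, FiniteDimensional 𝕜 W ∧ Module.finrank 𝕜 W ≤ n ∧
      ∀ x, ‖x‖ ≤ 1 → Metric.infDist (T x) (W : Set Y) ≤ δ := by
  have : Nonempty {L : Submodule 𝕜 Y // FiniteDimensional 𝕜 L ∧ Module.finrank 𝕜 L ≤ n} :=
    ⟨⟨⊥, inferInstance, by simp⟩⟩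
  obtain ⟨W, hW⟩ := exists_lt_of_ciInf_lt hδ
  refine ⟨W.1, W.2.1, W.2.2, fun x hx => ?_⟩
  exact (le_ciSup (bddAbove_infDist_image_closedBall T W.1)
    ⟨T x, x, by simpa using hx, rfl⟩).trans hW.le

theorem kolmogorovNumber_zero_le_norm (T : X →L[𝕜] Y) : kolmogorovNumber T 0 ≤ ‖T‖ := by
  refine (ciInf_le ⟨0, ?_⟩ ⟨⊥, inferInstance, by simp⟩).trans ?_
  · rintro _ ⟨_, rfl⟩
    exact Real.iSup_nonneg fun _ => Metric.infDist_nonneg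
  · refine Real.iSup_le ?_ (norm_nonneg _)
    rintro ⟨_, x, hx, rfl⟩
    exact (infDist_submodule_le_norm _ _).trans (T.unit_le_opNorm x (by simpa using hx))

/-- Determinants of an operator on a Hilbert space are controlled by its Kolmogorov numbers and
the Grothendieck number of the target. -/
theorem norm_det_apply_le_grothendieckNumberSpace_pow_mul_prod {n : ℕ} (T : H →L[𝕜] X)
    {x : Fin n → H} {b : Fin n → StrongDual 𝕜 X} (hx : ∀ i, ‖x i‖ ≤ 1) (hb : ∀ j, ‖b j‖ ≤ 1) :
    ‖(Matrix.of fun i j => b j (T (x i))).det‖ ≤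
      grothendieckNumberSpace 𝕜 X n ^ n * ∏ k ∈ Finset.range n, kolmogorovNumber T k := by
  -- Neither the infimum over subspaces nor the norm of a functional need be attained; one `ε`
  -- absorbs both losses and then tends to `0`.
  have key : ∀ ε ∈ Set.Ioo (0 : ℝ) 1,
      (1 - ε) ^ n * ‖(Matrix.of fun i j => b j (T (x i))).det‖ ≤
        grothendieckNumberSpace 𝕜 X n ^ n *
          ∏ k ∈ Finset.range n, (kolmogorovNumber T k + ε) := by
    intro ε hε
    choose L hL hLk hLd using fun k => exists_submodule_infDist_lt T k
      (lt_add_of_pos_right (kolmogorovNumber T k) hε.1)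
    exact pow_mul_norm_det_le_of_infDist_le T L hL hLk _
      (fun k => add_nonneg (kolmogorovNumber_nonneg T k) hε.1.le) hLd hx hb
      (sub_nonneg.2 hε.2.le) (sub_lt_self 1 hε.1)
  have hIoo : Set.Ioo (0 : ℝ) 1 ∈ nhdsWithin 0 (Set.Ioi 0) := Ioo_mem_nhdsGT one_pos
  have hl : Filter.Tendsto (fun ε : ℝ => (1 - ε) ^ n *
      ‖(Matrix.of fun i j => b j (T (x i))).det‖) (nhdsWithin 0 (Set.Ioi 0))
      (nhds ((1 - 0) ^ n * ‖(Matrix.of fun i j => b j (T (x i))).det‖)) :=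
    (Continuous.tendsto (by fun_prop) 0).mono_left nhdsWithin_le_nhds
  have hr : Filter.Tendsto (fun ε : ℝ => grothendieckNumberSpace 𝕜 X n ^ n *
      ∏ k ∈ Finset.range n, (kolmogorovNumber T k + ε)) (nhdsWithin 0 (Set.Ioi 0))
      (nhds (grothendieckNumberSpace 𝕜 X n ^ n *
        ∏ k ∈ Finset.range n, (kolmogorovNumber T k + 0))) :=
    (Continuous.tendsto (by fun_prop) 0).mono_left nhdsWithin_le_nhds
  simpa using le_of_tendsto_of_tendsto hl hr (Filter.mem_of_superset hIoo key)

end Grothendieck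

/-! ### Greedy errors as determinants. -/

section Greedy

variable {𝕜 : Type*} [RCLike 𝕜] {X : Type*} [NormedAddCommGroup X] [NormedSpace 𝕜 X]
  {K : Set X} {f : ℕ → X}

instance finiteDimensional_greedySpace (f : ℕ → X) (n : ℕ) :
    FiniteDimensional 𝕜 (greedySpace 𝕜 f n) :=
  FiniteDimensional.span_of_finite 𝕜 ((Set.finite_Iio n).image f)

theorem greedySpace_mono (f : ℕ → X) : Monotone (greedySpace 𝕜 f) := fun _ _ h =>
  Submodule.span_mono (Set.image_mono (Set.Iio_subset_Iio h))

theorem IsGreedySequence.antitone_greedyError (hf : IsGreedySequence 𝕜 K f) :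
    Antitone (greedyError 𝕜 f) := by
  intro m n h
  exact (Metric.infDist_le_infDist_of_subset (greedySpace_mono f h)
    ⟨0, Submodule.zero_mem _⟩).trans ((hf m).2 _ (hf n).1)

/-- The distance to a closed subspace is attained by a functional of norm at most one vanishing on
the subspace. -/
theorem exists_dual_apply_eq_infDist (W : Submodule 𝕜 X) [FiniteDimensional 𝕜 W] (x : X) :
    ∃ b : StrongDual 𝕜 X, ‖b‖ ≤ 1 ∧ (∀ w ∈ W, b w = 0) ∧
      b x = (Metric.infDist x (W : Set X) : 𝕜) := by
  -- Closedness makes `X ⧸ W` a normed space, whose norm is the distance to `W`; a norming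
  -- functional there is pulled back.
  have : IsClosed (W : Set X) := W.closed_of_finiteDimensional
  obtain ⟨g, hg, hgx⟩ := exists_dual_vector'' 𝕜 (W.mkQ x)
  refine ⟨g ∘L W.mkQL, ?_, fun w hw => ?_, ?_⟩
  · refine ContinuousLinearMap.opNorm_le_bound _ zero_le_one fun z => ?_
    refine (g.le_opNorm _).trans ?_
    exact mul_le_mul hg (Submodule.Quotient.norm_mk_le W z) (norm_nonneg _) zero_le_one
  · have : W.mkQ w = 0 := by simpa using hw
    simp [this]
  · have h := QuotientAddGroup.norm_mk (S := W.toAddSubgroup) x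
    exact hgx.trans (congrArg _ h)

/-- The functional `b j` kills `f i` for `i < j`, so the matrix is triangular with the greedy errors
on its diagonal. -/
theorem exists_dual_norm_det_eq_prod_greedyError {n : ℕ} (f : ℕ → X) :
    ∃ b : Fin n → StrongDual 𝕜 X, (∀ j, ‖b j‖ ≤ 1) ∧
      ‖(Matrix.of fun i j : Fin n => b j (f i)).det‖ =
        ∏ k ∈ Finset.range n, greedyError 𝕜 f k := by
  choose b hb hb0 hbd using fun j => exists_dual_apply_eq_infDist (greedySpace 𝕜 f j) (f j)
  refine ⟨fun j => b j, fun j => hb j, ?_⟩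
  rw [Matrix.det_of_isLowerTriangular, norm_prod,
    ← Fin.prod_univ_eq_prod_range (greedyError 𝕜 f)]
  · refine Finset.prod_congr rfl fun i _ => ?_
    rw [Matrix.of_apply, hbd, RCLike.norm_ofReal, abs_of_nonneg Metric.infDist_nonneg]
    rfl
  · intro i j hij
    exact hb0 j _ (Submodule.subset_span ⟨i, hij, rfl⟩)

theorem IsGreedySequence.greedyError_pred_le {H : Type*} [NormedAddCommGroup H]
    [InnerProductSpace 𝕜 H] [CompleteSpace H] (hf : IsGreedySequence 𝕜 K f) (T : H →L[𝕜] X)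
    (hK : K ⊆ T '' Metric.closedBall 0 1) {n : ℕ} (hn : n ≠ 0) :
    greedyError 𝕜 f (n - 1) ≤ grothendieckNumberSpace 𝕜 X n *
      (∏ k ∈ Finset.range n, kolmogorovNumber T k) ^ (1 / (n : ℝ)) := by
  have hP : 0 ≤ ∏ k ∈ Finset.range n, kolmogorovNumber T k :=
    Finset.prod_nonneg fun _ _ => kolmogorovNumber_nonneg T _
  obtain ⟨b, hb, hdet⟩ := exists_dual_norm_det_eq_prod_greedyError (𝕜 := 𝕜) (n := n) f
  choose x hx hTx using fun i => hK (hf i).1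
  have h1 := norm_det_apply_le_grothendieckNumberSpace_pow_mul_prod T
    (x := fun i : Fin n => x i) (fun i => by simpa using hx i) hb
  simp only [hTx] at h1
  rw [hdet] at h1
  have h2 : greedyError 𝕜 f (n - 1) ^ n ≤ ∏ k ∈ Finset.range n, greedyError 𝕜 f k := by
    calc greedyError 𝕜 f (n - 1) ^ n = ∏ k ∈ Finset.range n, greedyError 𝕜 f (n - 1) := by simp
      _ ≤ _ := Finset.prod_le_prod (fun _ _ => Metric.infDist_nonneg) fun k hk =>
        hf.antitone_greedyError (Nat.le_sub_one_of_lt (Finset.mem_range.1 hk))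
  refine le_of_pow_le_pow_left₀ hn (mul_nonneg (grothendieckNumberSpace_nonneg n)
    (Real.rpow_nonneg hP _)) ?_
  rw [mul_pow, one_div, Real.rpow_inv_natCast_pow hP hn]
  exact h2.trans h1

end Greedy

/-! ### Interpolation of Hadamard's inequality in `ℓ_p`. -/

/-- The power `|w|^u` with the phase of `w`, with value `0` at `w = 0`. -/
noncomputable def phasePow (w u : ℂ) : ℂ := w / ‖w‖ * Complex.exp (Real.log ‖w‖ * u)

theorem norm_phasePow {w : ℂ} (hw : w ≠ 0) (u : ℂ) : ‖phasePow w u‖ = ‖w‖ ^ u.re := by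
  have h : 0 < ‖w‖ := norm_pos_iff.2 hw
  rw [phasePow, norm_mul, norm_div, Complex.norm_real, norm_norm, div_self h.ne', one_mul,
    Complex.norm_exp, Real.rpow_def_of_pos h]
  simp

/-- Only an inequality survives at `w = 0`, since `0 ^ 0 = 1` for real powers. -/
theorem norm_phasePow_le (w u : ℂ) : ‖phasePow w u‖ ≤ ‖w‖ ^ u.re := by
  by_cases hw : w = 0
  · simpa [phasePow, hw] using Real.rpow_nonneg le_rfl _
  · exact (norm_phasePow hw u).le

theorem phasePow_one (w : ℂ) : phasePow w 1 = w := by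
  by_cases hw : w = 0
  · simp [phasePow, hw]
  · have h : 0 < ‖w‖ := norm_pos_iff.2 hw
    have h' : (‖w‖ : ℂ) ≠ 0 := by exact_mod_cast h.ne'
    rw [phasePow, mul_one, ← Complex.ofReal_exp, Real.exp_log h, div_mul_cancel₀ _ h']

theorem norm_phasePow_le_one {w u : ℂ} (hw : ‖w‖ ≤ 1) (hu : 0 ≤ u.re) : ‖phasePow w u‖ ≤ 1 :=
  (norm_phasePow_le w u).trans (Real.rpow_le_one (norm_nonneg _) hw hu)

theorem norm_le_one_of_sum_rpow_le_one {κ E : Type*} [Fintype κ] [SeminormedAddCommGroup E]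
    {p : ℝ} (hp : 0 < p) {x : κ → E} (hx : ∑ k, ‖x k‖ ^ p ≤ 1) (k : κ) : ‖x k‖ ≤ 1 := by
  have h : ‖x k‖ ^ p ≤ 1 := (Finset.single_le_sum (f := fun k => ‖x k‖ ^ p)
    (fun _ _ => by positivity) (Finset.mem_univ k)).trans hx
  by_contra! hk
  exact absurd h (not_le.2 (Real.one_lt_rpow hk hp))

open Complex.HadamardThreeLines in
/-- Interpolation of Hadamard's inequality between `ℓ₂` and the pair `ℓ_∞`, `ℓ₁`. -/
theorem Complex.norm_det_mul_le_of_sum_rpow_le_one {ι κ : Type*} [Fintype ι] [DecidableEq ι]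
    [Fintype κ] {p q : ℝ} (hpq : p.HolderConjugate q) (hp : 2 ≤ p) (A : Matrix ι κ ℂ)
    (B : Matrix κ ι ℂ) (hA : ∀ i, ∑ k, ‖A i k‖ ^ p ≤ 1) (hB : ∀ j, ∑ k, ‖B k j‖ ^ q ≤ 1) :
    ‖(A * B).det‖ ≤ ((Fintype.card ι : ℝ) ^ (1 / 2 - 1 / p)) ^ Fintype.card ι := by
  have hp0 : 0 < p := hpq.pos
  have hq0 : 0 < q := hpq.symm.pos
  -- On `re z = 0` the exponents have real parts `p / 2` and `q / 2`, giving `ℓ₂` rows and columns;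
  -- on `re z = 1` they have real parts `0` and `q`, giving `ℓ_∞` and `ℓ₁`. At `z = 1 - 2 / p` both
  -- exponents are `1` and `A`, `B` return.
  let A' : ℂ → Matrix ι κ ℂ := fun z => Matrix.of fun i k => phasePow (A i k) (p / 2 * (1 - z))
  let B' : ℂ → Matrix κ ι ℂ := fun z => Matrix.of fun k j => phasePow (B k j) (q / 2 * (1 + z))
  have hreA : ∀ z : ℂ, ((p : ℂ) / 2 * (1 - z)).re = p / 2 * (1 - z.re) := fun z => by
    have : ((p : ℂ) / 2 * (1 - z)) = ((p / 2 : ℝ) : ℂ) * (1 - z) := by push_cast; ring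
    rw [this, Complex.re_ofReal_mul]; simp
  have hreB : ∀ z : ℂ, ((q : ℂ) / 2 * (1 + z)).re = q / 2 * (1 + z.re) := fun z => by
    have : ((q : ℂ) / 2 * (1 + z)) = ((q / 2 : ℝ) : ℂ) * (1 + z) := by push_cast; ring
    rw [this, Complex.re_ofReal_mul]; simp
  have hA1 : ∀ i k, ‖A i k‖ ≤ 1 := fun i k => norm_le_one_of_sum_rpow_le_one hp0 (hA i) k
  have hB1 : ∀ k j, ‖B k j‖ ≤ 1 := fun k j => norm_le_one_of_sum_rpow_le_one hq0 (hB j) k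
  have hA'1 : ∀ z : ℂ, z.re ≤ 1 → ∀ i k, ‖A' z i k‖ ≤ 1 := fun z hz i k =>
    norm_phasePow_le_one (hA1 i k) (by rw [hreA]; exact mul_nonneg (by positivity) (by linarith))
  have hB'1 : ∀ z : ℂ, 0 ≤ z.re → ∀ k j, ‖B' z k j‖ ≤ 1 := fun z hz k j =>
    norm_phasePow_le_one (hB1 k j) (by rw [hreB]; exact mul_nonneg (by positivity) (by linarith))
  let F : ℂ → ℂ := fun z => (A' z * B' z).det
  have hF : Differentiable ℂ F := by
    simp only [F, A', B', Matrix.det_apply, Matrix.mul_apply, Matrix.of_apply, phasePow]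
    fun_prop
  -- This crude bound depends on `κ`, but it only feeds the boundedness hypothesis of the three
  -- lines theorem.
  have hbdd : BddAbove ((norm ∘ F) '' verticalClosedStrip 0 1) := by
    refine ⟨(√(Fintype.card ι) * Fintype.card κ) ^ Fintype.card ι, ?_⟩
    rintro _ ⟨z, hz, rfl⟩
    refine Matrix.norm_det_le_of_norm_entry_le _ (by positivity) fun i j => ?_
    rw [Matrix.mul_apply]
    refine (norm_sum_le _ _).trans ?_
    rw [← nsmul_one, ← Finset.card_univ]
    refine Finset.sum_le_card_nsmul _ _ _ fun k _ => ?_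
    rw [norm_mul]
    exact mul_le_one₀ (hA'1 z hz.2 i k) (norm_nonneg _) (hB'1 z hz.1 k j)
  have h0 : ∀ z ∈ Complex.re ⁻¹' {0}, ‖F z‖ ≤ 1 := by
    intro z hz
    have hz : z.re = 0 := hz
    refine (Matrix.norm_det_mul_le _ _).trans (mul_le_one₀ ?_ (by positivity) ?_)
    · refine Finset.prod_le_one (fun _ _ => Real.sqrt_nonneg _) fun i _ => ?_
      refine Real.sqrt_le_one.2 ?_
      refine (Finset.sum_le_sum fun k _ => ?_).trans (hA i)
      refine (pow_le_pow_left₀ (norm_nonneg _) (norm_phasePow_le _ _) 2).trans_eq ?_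
      rw [hreA, hz, ← Real.rpow_mul_natCast (norm_nonneg _)]
      congr 1; push_cast; ring
    · refine Finset.prod_le_one (fun _ _ => Real.sqrt_nonneg _) fun j _ => ?_
      refine Real.sqrt_le_one.2 ?_
      refine (Finset.sum_le_sum fun k _ => ?_).trans (hB j)
      refine (pow_le_pow_left₀ (norm_nonneg _) (norm_phasePow_le _ _) 2).trans_eq ?_
      rw [hreB, hz, ← Real.rpow_mul_natCast (norm_nonneg _)]
      congr 1; push_cast; ring
  have h1 : ∀ z ∈ Complex.re ⁻¹' {1}, ‖F z‖ ≤ √(Fintype.card ι) ^ Fintype.card ι := by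
    intro z hz
    have hz : z.re = 1 := hz
    rw [← mul_one √(Fintype.card ι : ℝ)]
    refine Matrix.norm_det_le_of_norm_entry_le _ zero_le_one fun i j => ?_
    rw [Matrix.mul_apply]
    refine (norm_sum_le _ _).trans ((Finset.sum_le_sum fun k _ => ?_).trans (hB j))
    rw [norm_mul]
    refine (mul_le_of_le_one_left (norm_nonneg _) (hA'1 z hz.le i k)).trans
      ((norm_phasePow_le _ _).trans_eq ?_)
    rw [hreB, hz]
    congr 1; ring
  have hθ : ((1 - 2 / p : ℝ) : ℂ) ∈ verticalClosedStrip 0 1 := by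
    have : 2 / p ≤ 1 := (div_le_one hp0).2 hp
    have : 0 ≤ 2 / p := by positivity
    simp only [verticalClosedStrip, Set.mem_preimage, Complex.ofReal_re, Set.mem_Icc]
    constructor <;> linarith
  have h := norm_le_interp_of_mem_verticalClosedStrip₀₁' F hθ hF.diffContOnCl hbdd h0 h1
  have hpC : (p : ℂ) ≠ 0 := by exact_mod_cast hp0.ne'
  have hAθ : A' ((1 - 2 / p : ℝ) : ℂ) = A := by
    ext i k
    have : (p : ℂ) / 2 * (1 - ((1 - 2 / p : ℝ) : ℂ)) = 1 := by push_cast; field_simp; ring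
    simp only [A', Matrix.of_apply, this, phasePow_one]
  have hBθ : B' ((1 - 2 / p : ℝ) : ℂ) = B := by
    ext k j
    have h2 : q / 2 * (1 + (1 - 2 / p)) = 1 := by
      have := hpq.inv_add_inv_eq_one
      have h3 : p⁻¹ = 1 - q⁻¹ := by linarith
      rw [div_eq_mul_inv 2 p, h3]; field_simp; ring
    have : (q : ℂ) / 2 * (1 + ((1 - 2 / p : ℝ) : ℂ)) = 1 := by exact_mod_cast h2
    simp only [B', Matrix.of_apply, this, phasePow_one]
  simp only [F, hAθ, hBθ, Complex.ofReal_re, Real.one_rpow, one_mul] at h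
  refine h.trans_eq ?_
  have hι : (0 : ℝ) ≤ Fintype.card ι := Nat.cast_nonneg _
  rw [Real.sqrt_eq_rpow, ← Real.rpow_mul_natCast hι, ← Real.rpow_mul hι,
    ← Real.rpow_mul_natCast hι]
  congr 1
  ring

/-- The norm-preserving embedding of an `RCLike` field into `ℂ`. -/
noncomputable def RCLike.toComplexHom (𝕜 : Type*) [RCLike 𝕜] : 𝕜 →+* ℂ where
  toFun z := ⟨RCLike.re z, RCLike.im z⟩
  map_one' := by apply Complex.ext <;> simp
  map_mul' z w := by apply Complex.ext <;> simp [RCLike.mul_re, RCLike.mul_im]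
  map_zero' := by apply Complex.ext <;> simp
  map_add' z w := by apply Complex.ext <;> simp

theorem RCLike.norm_toComplexHom {𝕜 : Type*} [RCLike 𝕜] (z : 𝕜) :
    ‖RCLike.toComplexHom 𝕜 z‖ = ‖z‖ := by
  rw [← sq_eq_sq₀ (norm_nonneg _) (norm_nonneg _), Complex.sq_norm, Complex.normSq_apply,
    RCLike.norm_sq_eq_def]
  rfl

theorem Matrix.norm_det_mul_le_of_sum_rpow_le_one_of_two_le {𝕜 ι κ : Type*} [RCLike 𝕜] [Fintype ι]
    [DecidableEq ι] [Fintype κ] {p q : ℝ} (hpq : p.HolderConjugate q) (hp : 2 ≤ p)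
    (A : Matrix ι κ 𝕜) (B : Matrix κ ι 𝕜) (hA : ∀ i, ∑ k, ‖A i k‖ ^ p ≤ 1)
    (hB : ∀ j, ∑ k, ‖B k j‖ ^ q ≤ 1) :
    ‖(A * B).det‖ ≤ ((Fintype.card ι : ℝ) ^ (1 / 2 - 1 / p)) ^ Fintype.card ι := by
  have := Complex.norm_det_mul_le_of_sum_rpow_le_one hpq hp (A.map (RCLike.toComplexHom 𝕜))
    (B.map (RCLike.toComplexHom 𝕜)) (by simpa [RCLike.norm_toComplexHom] using hA)
    (by simpa [RCLike.norm_toComplexHom] using hB)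
  rw [← Matrix.map_mul] at this
  have h := RingHom.map_det (RCLike.toComplexHom 𝕜) (A * B)
  rw [RingHom.mapMatrix_apply] at h
  rwa [← h, RCLike.norm_toComplexHom] at this

/-- Transposition exchanges `p` and `q`, one of which is at least `2`. -/
theorem Matrix.norm_det_mul_le_of_sum_rpow_le_one {𝕜 ι κ : Type*} [RCLike 𝕜] [Fintype ι]
    [DecidableEq ι] [Fintype κ] {p q : ℝ} (hpq : p.HolderConjugate q)
    (A : Matrix ι κ 𝕜) (B : Matrix κ ι 𝕜) (hA : ∀ i, ∑ k, ‖A i k‖ ^ p ≤ 1)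
    (hB : ∀ j, ∑ k, ‖B k j‖ ^ q ≤ 1) :
    ‖(A * B).det‖ ≤ ((Fintype.card ι : ℝ) ^ |p⁻¹ - 1 / 2|) ^ Fintype.card ι := by
  have hsum := hpq.inv_add_inv_eq_one
  rcases le_total 2 p with hp | hp
  · have h2 : p⁻¹ ≤ 1 / 2 := by rw [one_div]; exact inv_anti₀ two_pos hp
    rw [abs_of_nonpos (by linarith), neg_sub, ← one_div p]
    exact norm_det_mul_le_of_sum_rpow_le_one_of_two_le hpq hp A B hA hB
  · have h2 : 1 / 2 ≤ p⁻¹ := by rw [one_div]; exact inv_anti₀ hpq.pos hp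
    have hq : 2 ≤ q := (inv_le_inv₀ hpq.symm.pos two_pos).1 (by linarith)
    rw [abs_of_nonneg (by linarith), ← Matrix.det_transpose, Matrix.transpose_mul]
    have e : p⁻¹ - 1 / 2 = 1 / 2 - 1 / q := by rw [one_div q]; linarith
    rw [e]
    exact norm_det_mul_le_of_sum_rpow_le_one_of_two_le hpq.symm hq _ _ hB hA

/-! ### Transfer from `ℓ_p` to `L_p(μ)`. -/

/-- Testing `b` on the extremal vector of Hölder's inequality gives `S ≤ S ^ p⁻¹` for the sum `S`,
which is impossible when `S > 1`. -/
theorem sum_norm_dual_rpow_le_one {𝕜 X κ : Type*} [RCLike 𝕜] [NormedAddCommGroup X]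
    [NormedSpace 𝕜 X] [Fintype κ] {p q : ℝ} (hpq : p.HolderConjugate q) (e : κ → X)
    (he : ∀ a : κ → 𝕜, ‖∑ k, a k • e k‖ ≤ (∑ k, ‖a k‖ ^ p) ^ p⁻¹) {b : StrongDual 𝕜 X}
    (hb : ‖b‖ ≤ 1) : ∑ k, ‖b (e k)‖ ^ q ≤ 1 := by
  have hq0 : 0 < q := hpq.symm.pos
  set S := ∑ k, ‖b (e k)‖ ^ q with hS
  have hS0 : 0 ≤ S := Finset.sum_nonneg fun _ _ => by positivity
  let a : κ → 𝕜 := fun k => star (b (e k)) / ‖b (e k)‖ * ((‖b (e k)‖ ^ (q - 1) : ℝ) : 𝕜)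
  have ha : ∀ k, a k * b (e k) = ((‖b (e k)‖ ^ q : ℝ) : 𝕜) := by
    intro k
    by_cases h : b (e k) = 0
    · simp [a, h, Real.zero_rpow hq0.ne']
    · have h0 : 0 < ‖b (e k)‖ := norm_pos_iff.2 h
      have h1 : (‖b (e k)‖ : 𝕜) ≠ 0 := by exact_mod_cast h0.ne'
      have h2 : star (b (e k)) * b (e k) = (‖b (e k)‖ : 𝕜) ^ 2 := RCLike.conj_mul _
      have h3 : ‖b (e k)‖ ^ q = ‖b (e k)‖ * ‖b (e k)‖ ^ (q - 1) := by
        rw [Real.rpow_sub_one h0.ne']; field_simp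
      rw [h3, RCLike.ofReal_mul]
      simp only [a]
      rw [mul_right_comm, div_mul_eq_mul_div, h2]
      field_simp
  have hna : ∀ k, ‖a k‖ ^ p ≤ ‖b (e k)‖ ^ q := by
    intro k
    have h1 : ‖a k‖ ≤ ‖b (e k)‖ ^ (q - 1) := by
      simp only [a]
      rw [norm_mul, norm_div, norm_star, RCLike.norm_ofReal, RCLike.norm_ofReal, abs_norm,
        abs_of_nonneg (by positivity)]
      exact mul_le_of_le_one_left (by positivity) (div_self_le_one _)
    refine (Real.rpow_le_rpow (norm_nonneg _) h1 hpq.nonneg).trans_eq ?_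
    rw [← Real.rpow_mul (norm_nonneg _), hpq.symm.sub_one_mul_conj]
  have h1 : S ≤ S ^ p⁻¹ := by
    calc S = ‖((S : ℝ) : 𝕜)‖ := by rw [RCLike.norm_ofReal, abs_of_nonneg hS0]
      _ = ‖b (∑ k, a k • e k)‖ := by
        simp only [map_sum, map_smul, smul_eq_mul, ha, hS]
      _ ≤ ‖∑ k, a k • e k‖ := (b.le_opNorm _).trans (mul_le_of_le_one_left (norm_nonneg _) hb)
      _ ≤ (∑ k, ‖a k‖ ^ p) ^ p⁻¹ := he a
      _ ≤ S ^ p⁻¹ := Real.rpow_le_rpow (Finset.sum_nonneg fun _ _ => by positivity)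
          (Finset.sum_le_sum fun k _ => hna k) (inv_nonneg.2 hpq.nonneg)
  by_contra! h
  have h2 : S ^ p⁻¹ < S ^ (1 : ℝ) := Real.rpow_lt_rpow_of_exponent_lt h (inv_lt_one_of_one_lt₀ hpq.lt)
  rw [Real.rpow_one] at h2
  exact absurd h1 (not_le.2 h2)

theorem norm_det_dual_apply_le_of_lp_estimate {𝕜 X κ : Type*} [RCLike 𝕜] [NormedAddCommGroup X]
    [NormedSpace 𝕜 X] [Fintype κ] {p q : ℝ} (hpq : p.HolderConjugate q) (e : κ → X)
    (he : ∀ a : κ → 𝕜, ‖∑ k, a k • e k‖ ≤ (∑ k, ‖a k‖ ^ p) ^ p⁻¹) {n : ℕ} {x : Fin n → X}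
    {b : Fin n → StrongDual 𝕜 X} (hb : ∀ j, ‖b j‖ ≤ 1) (a : Fin n → κ → 𝕜)
    (hx : ∀ i, x i = ∑ k, a i k • e k) (ha : ∀ i, ∑ k, ‖a i k‖ ^ p ≤ 1) :
    ‖(Matrix.of fun i j => b j (x i)).det‖ ≤ ((n : ℝ) ^ |p⁻¹ - 1 / 2|) ^ n := by
  have h := Matrix.norm_det_mul_le_of_sum_rpow_le_one hpq (Matrix.of a)
    (Matrix.of fun k j => b j (e k)) ha fun j => sum_norm_dual_rpow_le_one hpq e he (hb j)
  have e : (Matrix.of a) * (Matrix.of fun k j => b j (e k)) = Matrix.of fun i j => b j (x i) := by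
    ext i j
    simp [Matrix.mul_apply, hx]
  simpa [e] using h

namespace MeasureTheory

variable {𝕜 Ω : Type*} [RCLike 𝕜] [MeasurableSpace Ω] {μ : Measure Ω} {p : ℝ≥0∞}

theorem norm_sum_smul_indicatorConstLp_rpow [Fact (1 ≤ p)] (hp : p ≠ ∞) {κ : Type*} [Fintype κ]
    {A : κ → Set Ω} (hA : ∀ k, MeasurableSet (A k)) (hμ : ∀ k, μ (A k) ≠ ∞)
    (hd : Pairwise fun k l => Disjoint (A k) (A l)) (c : κ → 𝕜) :
    ‖∑ k, c k • indicatorConstLp p (hA k) (hμ k) (1 : 𝕜)‖ ^ p.toReal =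
      ∑ k, ‖c k‖ ^ p.toReal * μ.real (A k) := by
  have hp0 : p ≠ 0 := (zero_lt_one.trans_le Fact.out).ne'
  have hpos : 0 < p.toReal := ENNReal.toReal_pos hp0 hp
  set F := ∑ k, c k • indicatorConstLp p (hA k) (hμ k) (1 : 𝕜) with hF
  have hae : ∀ᵐ ω ∂μ, ‖F ω‖ ^ p.toReal =
      ∑ k, (A k).indicator (fun _ => ‖c k‖ ^ p.toReal) ω := by
    have h1 : ∀ᵐ ω ∂μ, ∀ k, (c k • indicatorConstLp p (hA k) (hμ k) (1 : 𝕜) : Lp 𝕜 p μ) ω =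
        c k * (A k).indicator (fun _ => 1) ω := by
      refine ae_all_iff.2 fun k => ?_
      filter_upwards [Lp.coeFn_smul (c k) (indicatorConstLp p (hA k) (hμ k) (1 : 𝕜)),
        indicatorConstLp_coeFn (p := p) (hs := hA k) (hμs := hμ k) (c := (1 : 𝕜))] with ω h h'
      rw [h, Pi.smul_apply, h', smul_eq_mul]
    filter_upwards [h1, Lp.coeFn_finsetSum Finset.univ
      fun k => c k • indicatorConstLp p (hA k) (hμ k) (1 : 𝕜)] with ω h h'
    rw [hF, h', Finset.sum_apply]
    simp only [h]
    by_cases hω : ∃ k, ω ∈ A k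
    · obtain ⟨k, hk⟩ := hω
      have hne : ∀ l, l ≠ k → ω ∉ A l := fun l hl hωl =>
        Set.disjoint_left.1 (hd hl) hωl hk
      rw [Finset.sum_eq_single k, Finset.sum_eq_single k] <;> simp +contextual [hk, hne]
    · push Not at hω
      simp [hω, Real.zero_rpow hpos.ne']
  have h := (Lp.memLp F).eLpNorm_eq_integral_rpow_norm hp0 hp
  have hnn : 0 ≤ ∫ ω, ‖F ω‖ ^ p.toReal ∂μ := integral_nonneg fun _ => by positivity
  rw [Lp.norm_def, h, ENNReal.toReal_ofReal (by positivity), Real.rpow_inv_rpow hnn hpos.ne',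
    integral_congr_ae hae, integral_finsetSum]
  · refine Finset.sum_congr rfl fun k _ => ?_
    rw [integral_indicator_const _ (hA k), smul_eq_mul, mul_comm]
  · exact fun k _ => (integrable_indicator_iff (hA k)).2 (integrableOn_const (hμ k))

/-- Finitely many simple functions in `L_p` are combinations of the indicators of a common finite
family of disjoint sets of finite measure. -/
theorem exists_common_partition [Fact (1 ≤ p)] (hp : p ≠ ∞) {ι : Type*} [Fintype ι]
    (f : ι → Lp.simpleFunc 𝕜 p μ) :
    ∃ (s : Finset (ι → 𝕜)) (A : s → Set Ω) (hA : ∀ k, MeasurableSet (A k))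
      (hμ : ∀ k, μ (A k) ≠ ∞), (Pairwise fun k l => Disjoint (A k) (A l)) ∧
      ∀ i, (f i : Lp 𝕜 p μ) = ∑ k : s, k.1 i • indicatorConstLp p (hA k) (hμ k) (1 : 𝕜) := by
  classical
  have hp0 : p ≠ 0 := (zero_lt_one.trans_le Fact.out).ne'
  let g : ι → SimpleFunc Ω 𝕜 := fun i => Lp.simpleFunc.toSimpleFunc (f i)
  -- Atoms are the joint level sets of the `g i`. The zero vector is excluded, as its level set may
  -- have infinite measure.
  let s : Finset (ι → 𝕜) := (Fintype.piFinset fun i => (g i).range).filter (· ≠ 0)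
  let A : s → Set Ω := fun k => ⋂ i, g i ⁻¹' {k.1 i}
  have hA : ∀ k, MeasurableSet (A k) := fun k =>
    MeasurableSet.iInter fun i => (g i).measurableSet_preimage _
  have hμ : ∀ k, μ (A k) ≠ ∞ := by
    intro k
    obtain ⟨i, hi⟩ := Function.ne_iff.1 (Finset.mem_filter.1 k.2).2
    refine ((measure_mono (Set.iInter_subset _ i)).trans_lt ?_).ne
    exact SimpleFunc.measure_preimage_lt_top_of_memLp hp0 hp (g i)
      (Lp.simpleFunc.memLp (f i)) _ hi
  have hmem : ∀ (k : s) ω, ω ∈ A k ↔ k.1 = fun i => g i ω := by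
    intro k ω
    simp only [A, Set.mem_iInter, Set.mem_preimage, Set.mem_singleton_iff]
    exact ⟨fun h => funext fun i => (h i).symm, fun h i => by rw [h]⟩
  refine ⟨s, A, hA, hμ, fun k l hkl => ?_, fun i => ?_⟩
  · refine Set.disjoint_left.2 fun ω hk hl => hkl (Subtype.ext ?_)
    rw [(hmem k ω).1 hk, (hmem l ω).1 hl]
  · have h1 : ∀ᵐ ω ∂μ, ∀ k : s, (k.1 i • indicatorConstLp p (hA k) (hμ k) (1 : 𝕜) : Lp 𝕜 p μ) ω =
        k.1 i * (A k).indicator (fun _ => 1) ω := by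
      refine ae_all_iff.2 fun k => ?_
      filter_upwards [Lp.coeFn_smul (k.1 i) (indicatorConstLp p (hA k) (hμ k) (1 : 𝕜)),
        indicatorConstLp_coeFn (p := p) (hs := hA k) (hμs := hμ k) (c := (1 : 𝕜))] with ω h h'
      rw [h, Pi.smul_apply, h', smul_eq_mul]
    refine Lp.ext ?_
    filter_upwards [h1, Lp.coeFn_finsetSum Finset.univ
      fun k : s => k.1 i • indicatorConstLp p (hA k) (hμ k) (1 : 𝕜),
      Lp.simpleFunc.toSimpleFunc_eq_toFun (f i)] with ω h h' h''
    rw [h', Finset.sum_apply, ← h'']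
    simp only [h]
    by_cases hω : (fun i => g i ω) = 0
    · rw [Finset.sum_eq_zero]
      · exact congrFun hω i
      · intro k _
        have : ω ∉ A k := fun hk =>
          (Finset.mem_filter.1 k.2).2 (((hmem k ω).1 hk).trans hω)
        simp [this]
    · have hs : (fun i => g i ω) ∈ s := Finset.mem_filter.2
        ⟨Fintype.mem_piFinset.2 fun i => (g i).mem_range_self ω, hω⟩
      rw [Finset.sum_eq_single ⟨_, hs⟩]
      · have : ω ∈ A ⟨_, hs⟩ := (hmem _ ω).2 rfl
        simp [this, g]
      · intro k _ hk
        have : ω ∉ A k := fun h => hk (Subtype.ext ((hmem k ω).1 h))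
        simp [this]
      · simp

theorem norm_det_dual_apply_le_of_simpleFunc [Fact (1 ≤ p)] (hp1 : p ≠ 1) (hp : p ≠ ∞) {n : ℕ}
    (f : Fin n → Lp.simpleFunc 𝕜 p μ) {b : Fin n → StrongDual 𝕜 (Lp 𝕜 p μ)}
    (hf : ∀ i, ‖f i‖ ≤ 1) (hb : ∀ j, ‖b j‖ ≤ 1) :
    ‖(Matrix.of fun i j => b j (f i)).det‖ ≤ ((n : ℝ) ^ |(p⁻¹).toReal - 1 / 2|) ^ n := by
  have h1p : 1 < p := lt_of_le_of_ne Fact.out hp1.symm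
  have hp1' : 1 < p.toReal := by
    rw [← ENNReal.toReal_one]; exact (ENNReal.toReal_lt_toReal ENNReal.one_ne_top hp).2 h1p
  have hpos : 0 < p.toReal := zero_lt_one.trans hp1'
  have hpq := Real.HolderConjugate.conjExponent hp1'
  obtain ⟨s, A, hA, hμ, hd, hfs⟩ := exists_common_partition hp f
  let w : s → ℝ := fun k => μ.real (A k)
  have hw : ∀ k, 0 ≤ w k := fun k => measureReal_nonneg
  -- Indicators normalised in `L_p`, so that their span carries the `ℓ_p` norm of the coefficients;
  -- null atoms give zero vectors.
  let e : s → Lp 𝕜 p μ := fun k =>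
    ((w k ^ (-p.toReal⁻¹) : ℝ) : 𝕜) • indicatorConstLp p (hA k) (hμ k) (1 : 𝕜)
  have hinv : ∀ x : ℝ, 0 ≤ x → (x ^ p.toReal⁻¹) ^ p.toReal = x := fun x hx =>
    Real.rpow_inv_rpow hx hpos.ne'
  have he : ∀ a : s → 𝕜, ‖∑ k, a k • e k‖ ≤ (∑ k, ‖a k‖ ^ p.toReal) ^ p.toReal⁻¹ := by
    intro a
    rw [Real.le_rpow_inv_iff_of_pos (norm_nonneg _)
      (Finset.sum_nonneg fun _ _ => by positivity) hpos]
    simp only [e, smul_smul]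
    rw [norm_sum_smul_indicatorConstLp_rpow hp hA hμ hd]
    refine Finset.sum_le_sum fun k _ => ?_
    rw [norm_mul, RCLike.norm_ofReal, abs_of_nonneg (Real.rpow_nonneg (hw k) _),
      Real.mul_rpow (norm_nonneg _) (Real.rpow_nonneg (hw k) _), Real.rpow_neg (hw k),
      Real.inv_rpow (Real.rpow_nonneg (hw k) _), hinv _ (hw k), mul_assoc]
    exact mul_le_of_le_one_right (by positivity) (inv_mul_le_one (a := w k))
  let a : Fin n → s → 𝕜 := fun i k => k.1 i * ((w k ^ p.toReal⁻¹ : ℝ) : 𝕜)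
  have hx : ∀ i, (f i : Lp 𝕜 p μ) = ∑ k, a i k • e k := by
    intro i
    rw [hfs i]
    refine Finset.sum_congr rfl fun k _ => ?_
    rcases (hw k).eq_or_lt with h | h
    · have h0 : indicatorConstLp p (hA k) (hμ k) (1 : 𝕜) = 0 := by
        rw [← norm_eq_zero, norm_indicatorConstLp (zero_lt_one.trans h1p).ne' hp]
        change ‖(1 : 𝕜)‖ * w k ^ (1 / p.toReal) = 0
        rw [← h, Real.zero_rpow (by positivity), mul_zero]
      simp [e, h0]
    · simp only [a, e, smul_smul]
      rw [mul_assoc, ← RCLike.ofReal_mul, ← Real.rpow_add h, add_neg_cancel, Real.rpow_zero,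
        RCLike.ofReal_one, mul_one]
  have ha : ∀ i, ∑ k, ‖a i k‖ ^ p.toReal ≤ 1 := by
    intro i
    have h := norm_sum_smul_indicatorConstLp_rpow (𝕜 := 𝕜) hp hA hμ hd fun k => k.1 i
    rw [← hfs i] at h
    refine (Finset.sum_congr rfl fun k _ => ?_).trans_le
      (h.symm.trans_le (Real.rpow_le_one (norm_nonneg _) (hf i) hpos.le))
    rw [norm_mul, RCLike.norm_ofReal, abs_of_nonneg (Real.rpow_nonneg (hw k) _),
      Real.mul_rpow (norm_nonneg _) (Real.rpow_nonneg (hw k) _), hinv _ (hw k)]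
  rw [ENNReal.toReal_inv]
  exact norm_det_dual_apply_le_of_lp_estimate hpq e he hb a hx ha

attribute [local instance] Lp.simpleFunc.module Lp.simpleFunc.normedSpace

theorem norm_det_dual_apply_le_of_Lp [Fact (1 ≤ p)] (hp1 : p ≠ 1) (hp : p ≠ ∞) {n : ℕ}
    {x : Fin n → Lp 𝕜 p μ} {b : Fin n → StrongDual 𝕜 (Lp 𝕜 p μ)}
    (hx : ∀ i, ‖x i‖ ≤ 1) (hb : ∀ j, ‖b j‖ ≤ 1) :
    ‖(Matrix.of fun i j => b j (x i)).det‖ ≤ ((n : ℝ) ^ |(p⁻¹).toReal - 1 / 2|) ^ n := by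
  set D := ((n : ℝ) ^ |(p⁻¹).toReal - 1 / 2|) ^ n with hD
  -- Simple approximants may leave the unit ball, so the bound is put in homogeneous form, which is
  -- a closed condition on all of `L_p`.
  have key : ∀ x : Fin n → Lp 𝕜 p μ,
      ‖(Matrix.of fun i j => b j (x i)).det‖ ≤ D * ∏ i, ‖x i‖ := by
    intro x
    have hdense : DenseRange fun (f : Fin n → Lp.simpleFunc 𝕜 p μ) i => (f i : Lp 𝕜 p μ) :=
      DenseRange.piMap fun _ => Lp.simpleFunc.denseRange hp
    refine hdense.induction_on (p := fun x => ‖(Matrix.of fun i j => b j (x i)).det‖ ≤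
      D * ∏ i, ‖x i‖) x (isClosed_le ?_ (by fun_prop)) fun f => ?_
    · exact (Continuous.matrix_det (continuous_matrix fun i j => by fun_prop)).norm
    · let u : Fin n → Lp.simpleFunc 𝕜 p μ := fun i => ((‖f i‖⁻¹ : ℝ) : 𝕜) • f i
      have hu : ∀ i, ‖u i‖ ≤ 1 := by
        intro i
        rw [norm_smul, RCLike.norm_ofReal, abs_of_nonneg (by positivity)]
        exact inv_mul_le_one
      have hfu : ∀ i, (f i : Lp 𝕜 p μ) = (‖f i‖ : 𝕜) • (u i : Lp 𝕜 p μ) := by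
        intro i
        by_cases h : f i = 0
        · simp [u, h]
        · have h0 : (‖f i‖ : 𝕜) ≠ 0 := by exact_mod_cast norm_ne_zero_iff.2 h
          simp only [u, Lp.simpleFunc.coe_smul, smul_smul]
          rw [RCLike.ofReal_inv, mul_inv_cancel₀ h0, one_smul]
      have hdet : (Matrix.of fun i j => b j (f i)).det =
          (∏ i, (‖f i‖ : 𝕜)) * (Matrix.of fun i j => b j (u i)).det := by
        rw [← Matrix.det_mul_column]
        congr 1
        ext i j
        simp only [Matrix.of_apply]
        rw [hfu i, map_smul, smul_eq_mul]
      rw [hdet, norm_mul, norm_prod, mul_comm]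
      refine mul_le_mul (norm_det_dual_apply_le_of_simpleFunc hp1 hp u hu hb) ?_
        (by positivity) (by positivity)
      exact Finset.prod_le_prod (fun _ _ => norm_nonneg _) fun i _ => by simp
  refine (key x).trans (mul_le_of_le_one_right (by positivity) ?_)
  exact Finset.prod_le_one (fun _ _ => norm_nonneg _) fun i _ => hx i

/-- At `p = 1` and `p = ∞` the exponent is `1 / 2`, so plain Hadamard suffices. -/
theorem grothendieckNumberSpace_Lp_le [Fact (1 ≤ p)] {n : ℕ} (hn : n ≠ 0) :
    grothendieckNumberSpace 𝕜 (Lp 𝕜 p μ) n ≤ (n : ℝ) ^ |(p⁻¹).toReal - 1 / 2| := by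
  by_cases hp : p = 1 ∨ p = ∞
  · have : |(p⁻¹).toReal - 1 / 2| = 1 / 2 := by rcases hp with rfl | rfl <;> norm_num [abs_of_nonneg]
    rw [this, ← Real.sqrt_eq_rpow]
    exact grothendieckNumberSpace_le_sqrt hn
  · push Not at hp
    exact grothendieckNumberSpace_le hn (by positivity) fun x b hx hb =>
      norm_det_dual_apply_le_of_Lp hp.1 hp.2 hx hb

end MeasureTheory

/-! ### Polynomial decay of the widths and conclusion. -/

theorem prod_le_pow_of_le_mul_rpow_neg {d : ℕ → ℝ} {D s : ℝ} (hd : ∀ k, 0 ≤ d k) (hD : 0 ≤ D)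
    (hs : 0 ≤ s) (h0 : d 0 ≤ D) (h : ∀ k : ℕ, 1 ≤ k → d k ≤ D * (k : ℝ) ^ (-s)) {n : ℕ}
    (hn : n ≠ 0) :
    ∏ k ∈ Finset.range n, d k ≤ (D * Real.exp (2 * s) * (n : ℝ) ^ (-s)) ^ n := by
  obtain ⟨m, rfl⟩ := Nat.exists_eq_succ_of_ne_zero hn
  have h1 : ∏ k ∈ Finset.range (m + 1), d k ≤ D ^ (m + 1) * (m.factorial : ℝ) ^ (-s) := by
    rw [Finset.prod_range_succ']
    calc (∏ k ∈ Finset.range m, d (k + 1)) * d 0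
        ≤ (∏ k ∈ Finset.range m, D * ((k + 1 : ℕ) : ℝ) ^ (-s)) * D :=
          mul_le_mul (Finset.prod_le_prod (fun _ _ => hd _) fun k _ => h (k + 1) (by omega)) h0
            (hd 0) (Finset.prod_nonneg fun _ _ => by positivity)
      _ = D ^ (m + 1) * (m.factorial : ℝ) ^ (-s) := by
          rw [Finset.prod_mul_distrib, Finset.prod_const, Finset.card_range,
            Real.finsetProd_rpow _ _ fun _ _ => Nat.cast_nonneg _, ← Nat.cast_prod,
            Finset.prod_range_add_one_eq_factorial]
          ring
  have hf : 0 < (m.factorial : ℝ) := by positivity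
  -- With `n = m + 1`, this combines `n ^ n / n! ≤ e ^ n` with `n ≤ e ^ n`, the latter paying for
  -- the missing factor in `(n - 1)!`; hence `e ^ (2n)`.
  have h2 : ((m + 1 : ℕ) : ℝ) ^ (m + 1) / Real.exp (2 * (m + 1 : ℕ)) ≤ m.factorial := by
    have h3 := Real.pow_div_factorial_le_exp ((m + 1 : ℕ) : ℝ) (by positivity) (m + 1)
    have h4 : ((m + 1 : ℕ) : ℝ) ≤ Real.exp ((m + 1 : ℕ) : ℝ) :=
      (by linarith : ((m + 1 : ℕ) : ℝ) ≤ (m + 1 : ℕ) + 1).trans (Real.add_one_le_exp _)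
    rw [div_le_iff₀ (by positivity)] at h3
    rw [div_le_iff₀ (Real.exp_pos _)]
    refine h3.trans ?_
    rw [Nat.factorial_succ, Nat.cast_mul, two_mul, Real.exp_add]
    calc Real.exp ((m + 1 : ℕ) : ℝ) * (((m + 1 : ℕ) : ℝ) * m.factorial)
        ≤ Real.exp ((m + 1 : ℕ) : ℝ) * (Real.exp ((m + 1 : ℕ) : ℝ) * m.factorial) := by gcongr
      _ = _ := by ring
  refine h1.trans ?_
  rw [mul_assoc D, mul_pow D]
  refine mul_le_mul_of_nonneg_left ?_ (by positivity)
  refine (Real.rpow_le_rpow_of_nonpos (by positivity) h2 (by linarith)).trans_eq ?_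
  rw [Real.div_rpow (by positivity) (Real.exp_pos _).le, ← Real.exp_mul, mul_pow, ← Real.exp_nat_mul,
    ← Real.rpow_natCast_mul (by positivity), ← Real.rpow_mul_natCast (by positivity),
    div_eq_mul_inv, ← Real.exp_neg, mul_comm]
  congr 2 <;> ring

theorem mainTheorem4 {𝕜 : Type*} [RCLike 𝕜] :
    (∀ (X : Type*) [NormedAddCommGroup X] [NormedSpace 𝕜 X] [CompleteSpace X]
        (T : lp (fun _ : ℕ => 𝕜) 2 →L[𝕜] X), IsCompactOperator T →
      ∀ K : Set X, IsCompact K → K ⊆ T '' Metric.closedBall 0 1 →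
      ∀ f : ℕ → X, IsGreedySequence 𝕜 K f →
      ∀ n : ℕ, 1 ≤ n →
        greedyError 𝕜 f (3 * n - 1) ≤
          3 * Real.exp 1 ^ 2 * grothendieckNumberSpace 𝕜 X n *
            (∏ k ∈ Finset.range n, kolmogorovNumber T k) ^ (1 / (n : ℝ))) ∧
    (∀ (p : ℝ≥0∞) [Fact (1 ≤ p)] (s C₀ M : ℝ), |1 / 2 - (p⁻¹).toReal| < s →
      ∃ C : ℝ, 0 < C ∧
        ∀ (Ω : Type*) [MeasurableSpace Ω] (μ : MeasureTheory.Measure Ω)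
          (T : lp (fun _ : ℕ => 𝕜) 2 →L[𝕜] MeasureTheory.Lp 𝕜 p μ), IsCompactOperator T →
        ‖T‖ ≤ M →
        (∀ n : ℕ, 1 ≤ n → kolmogorovNumber T n ≤ C₀ * (n : ℝ) ^ (-s)) →
        ∀ K : Set (MeasureTheory.Lp 𝕜 p μ), IsCompact K → K ⊆ T '' Metric.closedBall 0 1 →
        ∀ f : ℕ → MeasureTheory.Lp 𝕜 p μ, IsGreedySequence 𝕜 K f →
        ∀ n : ℕ, 1 ≤ n →
          greedyError 𝕜 f (3 * n - 1) ≤ C * (n : ℝ) ^ (|(p⁻¹).toReal - 1 / 2| - s)) := by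

  constructor
  · intro X _ _ _ T _ K _ hK f hf n hn
    have hn0 : n ≠ 0 := by omega
    have h1 := (hf.antitone_greedyError (by omega : n - 1 ≤ 3 * n - 1)).trans
      (hf.greedyError_pred_le T hK hn0)
    have hP : 0 ≤ ∏ k ∈ Finset.range n, kolmogorovNumber T k :=
      Finset.prod_nonneg fun _ _ => kolmogorovNumber_nonneg T _
    -- The bound at index `n - 1` already holds with constant `1`; the factor `3e²` is slack.
    have h3 : 1 ≤ 3 * Real.exp 1 ^ 2 := by
      have := one_le_pow₀ (Real.one_le_exp zero_le_one) (n := 2)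
      linarith
    refine h1.trans ?_
    rw [mul_assoc (3 * Real.exp 1 ^ 2)]
    exact le_mul_of_one_le_left
      (mul_nonneg (grothendieckNumberSpace_nonneg n) (Real.rpow_nonneg hP _)) h3
  · intro p _ s C₀ M hs
    have hs0 : 0 ≤ s := (abs_nonneg _).trans hs.le
    -- `M` covers `d_0(T)` and `C₀` the later widths; the `1` keeps `D` positive whatever their
    -- signs.
    set D := max 1 (max C₀ M) with hD
    have hD0 : 0 < D := zero_lt_one.trans_le (le_max_left _ _)
    refine ⟨D * Real.exp (2 * s), by positivity, ?_⟩
    intro Ω _ μ T _ hT hd K _ hK f hf n hn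
    have hn0 : n ≠ 0 := by omega
    have hn' : (0 : ℝ) < n := by positivity
    have hP : 0 ≤ ∏ k ∈ Finset.range n, kolmogorovNumber T k :=
      Finset.prod_nonneg fun _ _ => kolmogorovNumber_nonneg T _
    have hprod := prod_le_pow_of_le_mul_rpow_neg (kolmogorovNumber_nonneg T) hD0.le hs0
      ((kolmogorovNumber_zero_le_norm T).trans
        (hT.trans ((le_max_right _ _).trans (le_max_right _ _))))
      (fun k hk => (hd k hk).trans (mul_le_mul_of_nonneg_right
        ((le_max_left _ _).trans (le_max_right _ _)) (by positivity))) hn0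
    calc greedyError 𝕜 f (3 * n - 1)
        ≤ greedyError 𝕜 f (n - 1) := hf.antitone_greedyError (by omega)
      _ ≤ grothendieckNumberSpace 𝕜 (MeasureTheory.Lp 𝕜 p μ) n *
          (∏ k ∈ Finset.range n, kolmogorovNumber T k) ^ (1 / (n : ℝ)) :=
          hf.greedyError_pred_le T hK hn0
      _ ≤ (n : ℝ) ^ |(p⁻¹).toReal - 1 / 2| * (D * Real.exp (2 * s) * (n : ℝ) ^ (-s)) := by
          refine mul_le_mul (MeasureTheory.grothendieckNumberSpace_Lp_le hn0) ?_
            (Real.rpow_nonneg hP _) (by positivity)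
          rw [one_div]
          exact (Real.rpow_inv_natCast_le_iff hn0 hP (by positivity)).2 hprod
      _ = D * Real.exp (2 * s) * (n : ℝ) ^ (|(p⁻¹).toReal - 1 / 2| - s) := by
          rw [sub_eq_add_neg _ s, Real.rpow_add hn']
          ring
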